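/- All rings are associative and unital (the zero ring is allowed), and "module" means right module. A ring $R$ has *unbounded generating number* (UGN) if, for every positive integer $n$, there is no $R$-module epimorphism $R^n\to R^{n+1}$. For a ring $R$, a group $G$ and a subset $X\subseteq G$, the *translation ring* $T_G(X,R)$ is the ring of all $X\times X$ matrices $M$ over $R$ for which there is a finite set $K\subseteq G$ such that $M(x,y)=0$ whenever $x,y\in X$ and $y\notin Kx$, with entrywise addition and with multiplication $(MN)(x,y)=\sum_{z\in X}M(x,z)N(z,y)$ (a sum with only finitely many nonzero terms); for $X=\emptyset$ it is the zero ring. **Proposition A.** Let $G$ be a group and $X$ a subset of $G$. Then the following two statements are equivalent. (i) For every ring $R$, the ring $T_G(X,R)$ has UGN if and only if $R$ has UGN. (ii) $X$ is amenable with respect to $G$, that is, there is a function $\mu:\mathcal P(G)\to[0,\infty]$ such that $\mu(A\cup B)=\mu(A)+\mu(B)$ for all $A,B\subseteq G$ with $A\cap B=\emptyset$, $\mu(gA)=\mu(A)$ for all $g\in G$ and $A\subseteq G$, and $\mu(X)=1$. -/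

import Mathlib

universe u v

/-- A ring `R` has *unbounded generating number* (UGN) if, for every positive integer `n`, there is
no epimorphism `Rⁿ → Rⁿ⁺¹` of right `R`-modules (that is, of modules over `Rᵐᵒᵖ`). -/
def HasUGN (R : Type*) [Ring R] : Prop :=
  ∀ n : ℕ, 0 < n →
    ¬ ∃ f : (Fin n → R) →ₗ[Rᵐᵒᵖ] (Fin (n + 1) → R), Function.Surjective f

/-- A subset `X` of a group `G` is *amenable with respect to `G`* if there is a finitely additive,
left-invariant function `μ : 𝒫(G) → [0, ∞]` with `μ(X) = 1`. -/
def IsAmenableWrt {G : Type*} [Group G] (X : Set G) : Prop :=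
  ∃ μ : Set G → ENNReal,
    (∀ A B : Set G, A ∩ B = ∅ → μ (A ∪ B) = μ A + μ B) ∧
    (∀ (g : G) (A : Set G), μ ((fun a => g * a) '' A) = μ A) ∧
    μ X = 1

/-- The `X × X` matrices `M` over `R` for which there is a finite set `K ⊆ G` such that
`M(x, y) = 0` whenever `y ∉ Kx`, as an additive group. -/
def translationMatrices {G : Type*} [Group G] (X : Set G) (R : Type*) [Ring R] :
    AddSubgroup (Matrix X X R) where
  carrier := {M | ∃ K : Set G, K.Finite ∧
    ∀ x y : X, (y : G) ∉ (fun k => k * (x : G)) '' K → M x y = 0}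
  zero_mem' := ⟨∅, Set.finite_empty, fun _ _ _ => rfl⟩
  add_mem' := by
    rintro M N ⟨K, hK, hM⟩ ⟨L, hL, hN⟩
    refine ⟨K ∪ L, hK.union hL, fun x y h => ?_⟩
    rw [Set.image_union, Set.mem_union, not_or] at h
    rw [Matrix.add_apply, hM x y h.1, hN x y h.2, add_zero]
  neg_mem' := by
    rintro M ⟨K, hK, hM⟩
    exact ⟨K, hK, fun x y h => by rw [Matrix.neg_apply, hM x y h, neg_zero]⟩

/-- The *translation ring* `T_G(X, R)` of `X` with respect to `G` over `R`. For `X = ∅` it is the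
zero ring. -/
def TranslationRing {G : Type*} [Group G] (X : Set G) (R : Type*) [Ring R] : Type _ :=
  translationMatrices X R

namespace TranslationRing

variable {G : Type*} [Group G] {X : Set G} {R : Type*} [Ring R]

/-- The matrix underlying an element of the translation ring. -/
def toMatrix (M : TranslationRing X R) : Matrix X X R := M.1

theorem toMatrix_mem (M : TranslationRing X R) : ∃ K : Set G, K.Finite ∧
    ∀ x y : X, (y : G) ∉ (fun k => k * (x : G)) '' K → M.toMatrix x y = 0 := M.2

theorem ext_matrix {M N : TranslationRing X R}
    (h : ∀ x y, M.toMatrix x y = N.toMatrix x y) : M = N :=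
  Subtype.ext (Matrix.ext h)

instance : AddCommGroup (TranslationRing X R) :=
  inferInstanceAs (AddCommGroup (translationMatrices X R))

theorem add_apply (M N : TranslationRing X R) (x y : X) :
    (M + N).toMatrix x y = M.toMatrix x y + N.toMatrix x y := rfl

theorem zero_apply (x y : X) : (0 : TranslationRing X R).toMatrix x y = 0 := rfl

/-- Every row of a matrix in the translation ring has finite support. -/
theorem finite_row (M : TranslationRing X R) (x : X) :
    {y : X | M.toMatrix x y ≠ 0}.Finite := by
  obtain ⟨K, hK, hM⟩ := M.toMatrix_mem
  refine Set.Finite.subset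
    ((hK.image fun k => k * (x : G)).preimage Subtype.val_injective.injOn) fun y hy => ?_
  by_contra h
  exact hy (hM x y h)

theorem mul_mem (M N : TranslationRing X R) :
    (fun x y => ∑ᶠ z : X, M.toMatrix x z * N.toMatrix z y : Matrix X X R) ∈
      translationMatrices X R := by
  obtain ⟨K, hK, hM⟩ := M.toMatrix_mem
  obtain ⟨L, hL, hN⟩ := N.toMatrix_mem
  refine ⟨Set.image2 (fun l k => l * k) L K, hL.image2 _ hK, fun x y h => ?_⟩
  refine (finsum_congr fun z => ?_).trans finsum_zero
  by_cases hz : (z : G) ∈ (fun k => k * (x : G)) '' K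
  · obtain ⟨k, hk, hkz⟩ := hz
    have hy : (y : G) ∉ (fun l => l * (z : G)) '' L := by
      rintro ⟨l, hl, hly⟩
      exact h ⟨l * k, ⟨l, hl, k, hk, rfl⟩, by
        simp only at hkz hly ⊢
        rw [mul_assoc, hkz, hly]⟩
    rw [hN z y hy, mul_zero]
  · rw [hM x z hz, zero_mul]

/-- `(MN)(x, y) = ∑_{z ∈ X} M(x, z) N(z, y)`, a sum with only finitely many nonzero terms. -/
noncomputable instance : Mul (TranslationRing X R) where
  mul M N := ⟨fun x y => ∑ᶠ z : X, M.toMatrix x z * N.toMatrix z y, mul_mem M N⟩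

theorem mul_apply (M N : TranslationRing X R) (x y : X) :
    (M * N).toMatrix x y = ∑ᶠ z : X, M.toMatrix x z * N.toMatrix z y := rfl

theorem mul_apply_eq_sum (M N : TranslationRing X R) (x y : X) (s : Finset X)
    (hs : ∀ z, M.toMatrix x z ≠ 0 → z ∈ s) :
    (M * N).toMatrix x y = ∑ z ∈ s, M.toMatrix x z * N.toMatrix z y := by
  rw [mul_apply]
  refine finsum_eq_sum_of_support_subset _ fun z hz => hs z fun h => ?_
  exact hz (by simp only [h, zero_mul])

open scoped Classical in
/-- The identity matrix. -/
noncomputable instance : One (TranslationRing X R) where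
  one := ⟨(1 : Matrix X X R), {1}, Set.finite_singleton 1, fun x y h =>
    Matrix.one_apply_ne fun hxy => h ⟨1, rfl, by simp [hxy]⟩⟩

open scoped Classical in
theorem one_apply (x y : X) :
    (1 : TranslationRing X R).toMatrix x y = if x = y then 1 else 0 :=
  Matrix.one_apply

theorem mul_assoc_aux (M N P : TranslationRing X R) : M * N * P = M * (N * P) := by
  classical
  refine ext_matrix fun x y => ?_
  let s : Finset X := (M.finite_row x).toFinset
  let t : Finset X := s.biUnion fun w => (N.finite_row w).toFinset
  have hs : ∀ z, M.toMatrix x z ≠ 0 → z ∈ s := fun z hz => by simpa [s] using hz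
  have ht : ∀ w ∈ s, ∀ z, N.toMatrix w z ≠ 0 → z ∈ t := fun w hw z hz =>
    Finset.mem_biUnion.2 ⟨w, hw, by simpa using hz⟩
  have hMN : ∀ z, (M * N).toMatrix x z ≠ 0 → z ∈ t := by
    intro z hz
    rw [mul_apply_eq_sum M N x z s hs] at hz
    obtain ⟨w, hw, hwz⟩ := Finset.exists_ne_zero_of_sum_ne_zero hz
    exact ht w hw z (right_ne_zero_of_mul hwz)
  rw [mul_apply_eq_sum (M * N) P x y t hMN, mul_apply_eq_sum M (N * P) x y s hs]
  have h₁ : ∀ z ∈ t, (M * N).toMatrix x z * P.toMatrix z y =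
      ∑ w ∈ s, M.toMatrix x w * N.toMatrix w z * P.toMatrix z y := fun z _ => by
    rw [mul_apply_eq_sum M N x z s hs, Finset.sum_mul]
  have h₂ : ∀ w ∈ s, M.toMatrix x w * (N * P).toMatrix w y =
      ∑ z ∈ t, M.toMatrix x w * N.toMatrix w z * P.toMatrix z y := fun w hw => by
    rw [mul_apply_eq_sum N P w y t (ht w hw), Finset.mul_sum]
    exact Finset.sum_congr rfl fun z _ => (mul_assoc _ _ _).symm
  rw [Finset.sum_congr rfl h₁, Finset.sum_congr rfl h₂, Finset.sum_comm]

theorem left_distrib_aux (M N P : TranslationRing X R) : M * (N + P) = M * N + M * P := by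
  refine ext_matrix fun x y => ?_
  have hs : ∀ z, M.toMatrix x z ≠ 0 → z ∈ (M.finite_row x).toFinset := fun z hz => by
    simpa using hz
  rw [add_apply, mul_apply_eq_sum _ _ x y _ hs, mul_apply_eq_sum _ _ x y _ hs,
    mul_apply_eq_sum _ _ x y _ hs, ← Finset.sum_add_distrib]
  exact Finset.sum_congr rfl fun z _ => by rw [add_apply, mul_add]

theorem right_distrib_aux (M N P : TranslationRing X R) : (M + N) * P = M * P + N * P := by
  classical
  refine ext_matrix fun x y => ?_
  let s : Finset X := (M.finite_row x).toFinset ∪ (N.finite_row x).toFinset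
  have hM : ∀ z, M.toMatrix x z ≠ 0 → z ∈ s := fun z hz =>
    Finset.mem_union_left _ (by simpa using hz)
  have hN : ∀ z, N.toMatrix x z ≠ 0 → z ∈ s := fun z hz =>
    Finset.mem_union_right _ (by simpa using hz)
  have hMN : ∀ z, (M + N).toMatrix x z ≠ 0 → z ∈ s := fun z hz => by
    by_contra h
    refine hz ?_
    rw [add_apply, by_contra fun h' => h (hM z h'), by_contra fun h' => h (hN z h'), add_zero]
  rw [add_apply, mul_apply_eq_sum _ _ x y s hMN, mul_apply_eq_sum _ _ x y s hM,
    mul_apply_eq_sum _ _ x y s hN, ← Finset.sum_add_distrib]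
  exact Finset.sum_congr rfl fun z _ => by rw [add_apply, add_mul]

theorem one_mul_aux (M : TranslationRing X R) : 1 * M = M := by
  refine ext_matrix fun x y => ?_
  rw [mul_apply_eq_sum 1 M x y {x} fun z hz => ?_, Finset.sum_singleton, one_apply, if_pos rfl,
    one_mul]
  by_contra h
  exact hz (by rw [one_apply, if_neg fun hxz => h (Finset.mem_singleton.2 hxz.symm)])

theorem mul_one_aux (M : TranslationRing X R) : M * 1 = M := by
  refine ext_matrix fun x y => ?_
  rw [mul_apply, finsum_eq_single _ y fun z hz => by rw [one_apply, if_neg hz, mul_zero],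
    one_apply, if_pos rfl, mul_one]

noncomputable instance : Ring (TranslationRing X R) :=
  { (inferInstance : AddCommGroup (TranslationRing X R)),
    (inferInstance : Mul (TranslationRing X R)),
    (inferInstance : One (TranslationRing X R)) with
    left_distrib := left_distrib_aux
    right_distrib := right_distrib_aux
    zero_mul := fun M => add_eq_left.1 (show 0 * M + 0 * M = 0 * M by
      rw [← right_distrib_aux, add_zero])
    mul_zero := fun M => add_eq_left.1 (show M * 0 + M * 0 = M * 0 by
      rw [← left_distrib_aux, add_zero])
    mul_assoc := mul_assoc_aux
    one_mul := one_mul_aux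
    mul_one := mul_one_aux }

end TranslationRing

/-! Everything passes through the Følner condition `HasFolner`. UGN says that `A * B = 1` is
impossible for `A` of size (n+1) × n with n > 0, so it pulls back along ring homomorphisms; the
scalar embedding therefore gives one implication of (i) for every X.

If Følner fails, Hall's theorem injects n+1 copies of X into n copies with bounded displacement
(`exists_injective_of_not_hasFolner`). This one map is a double obstruction. Read as 0-1 matrices,
it destroys UGN of the translation ring over any R. Cut into finitely many translated pieces, it
would force n+1 ≤ n for an invariant μ with μ(X) = 1.

If Følner holds, restricting `A * B = 1` to a Følner set yields an impossible identity over R. An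
ultralimit of normalised counting measures on Følner sets gives a mean on X, which a supremum over
piecewise translations makes invariant on G. -/

open Filter Topology

/-! ### UGN in terms of matrices -/

/-- Right-module maps between finite free modules are matrices; such a map is onto exactly when the
matrix has a right inverse. -/
theorem exists_surjective_iff_exists_matrix_mul_eq_one {R m n : Type*} [Ring R] [Fintype m]
    [Fintype n] [DecidableEq m] :
    (∃ f : (n → R) →ₗ[Rᵐᵒᵖ] (m → R), Function.Surjective f) ↔
      ∃ (A : Matrix m n R) (B : Matrix n m R), A * B = 1 := by
  classical
  constructor
  · rintro ⟨f, hf⟩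
    choose b hb using fun i : m => hf (Pi.single i 1)
    refine ⟨Matrix.of fun i j => f (Pi.single j 1) i, Matrix.of fun j i => b i j, ?_⟩
    ext i k
    have hsum : b k = ∑ j, MulOpposite.op (b k j) • (Pi.single j 1 : n → R) := by
      ext j
      simp [Finset.sum_apply, Pi.single_apply]
    have := congrFun (hb k) i
    rw [hsum, map_sum] at this
    simp only [map_smul, Finset.sum_apply, Pi.smul_apply, MulOpposite.smul_eq_mul_unop,
      MulOpposite.unop_op] at this
    simp only [Matrix.mul_apply, Matrix.of_apply]
    rw [this, Matrix.one_apply, Pi.single_apply]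
  · rintro ⟨A, B, h⟩
    refine ⟨{ toFun := fun v => A.mulVec v
              map_add' := A.mulVec_add
              map_smul' := fun r v => A.mulVec_smul r v }, fun w => ⟨B.mulVec w, ?_⟩⟩
    simp [h]

theorem hasUGN_iff_matrix {R : Type*} [Ring R] :
    HasUGN R ↔ ∀ n : ℕ, 0 < n → ∀ (A : Matrix (Fin (n + 1)) (Fin n) R)
      (B : Matrix (Fin n) (Fin (n + 1)) R), A * B ≠ 1 := by
  simp only [HasUGN, exists_surjective_iff_exists_matrix_mul_eq_one, not_exists, ne_eq]

theorem HasUGN.nontrivial {R : Type*} [Ring R] (h : HasUGN R) : Nontrivial R := by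
  by_contra hR
  rw [not_nontrivial_iff_subsingleton] at hR
  exact hasUGN_iff_matrix.1 h 1 one_pos 0 0 (Subsingleton.elim _ _)

/-- Over a ring with UGN, a matrix with a right inverse has at most as many rows as columns. -/
theorem HasUGN.card_le {R m n : Type*} [Ring R] (h : HasUGN R) [Fintype m] [Fintype n]
    [DecidableEq m] (A : Matrix m n R) (B : Matrix n m R) (hAB : A * B = 1) :
    Fintype.card m ≤ Fintype.card n := by
  classical
  have := h.nontrivial
  by_contra! hlt
  obtain hn | hn := Nat.eq_zero_or_pos (Fintype.card n)
  -- UGN only speaks of n > 0; with no columns the product is 0, which is not 1 as R is nontrivial.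
  · have : IsEmpty n := Fintype.card_eq_zero_iff.1 hn
    rw [hn] at hlt
    obtain ⟨i⟩ := Fintype.card_pos_iff.1 hlt
    have := congrFun (congrFun hAB i) i
    rw [Matrix.mul_apply, Matrix.one_apply_eq] at this
    simp at this
  · obtain ⟨e⟩ : Nonempty (Fin (Fintype.card n + 1) ↪ m) :=
      Function.Embedding.nonempty_of_card_le (by simpa using hlt)
    let d := Fintype.equivFin n
    refine hasUGN_iff_matrix.1 h _ hn (A.submatrix e d.symm) (B.submatrix d.symm e) ?_
    rw [Matrix.submatrix_mul_equiv, hAB, Matrix.submatrix_one _ e.injective]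

theorem HasUGN.of_ringHom {R S : Type*} [Ring R] [Ring S] (f : R →+* S) (h : HasUGN S) :
    HasUGN R := by
  rw [hasUGN_iff_matrix] at h ⊢
  intro n hn A B hAB
  refine h n hn (A.map f) (B.map f) ?_
  rw [← Matrix.map_mul, hAB, Matrix.map_one f f.map_zero f.map_one]

theorem hasUGN_of_commRing (R : Type*) [CommRing R] [Nontrivial R] : HasUGN R := by
  rw [hasUGN_iff_matrix]
  intro n _ A B hAB
  have := card_le_of_surjective R A.mulVecLin fun w => ⟨B.mulVec w, by simp [hAB]⟩
  simp at this

/-! ### Scalars and entries of the translation ring -/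

namespace TranslationRing

variable {G : Type*} [Group G] {X : Set G} {R : Type*} [Ring R]

open scoped Classical in
/-- The scalar matrix with diagonal entry `r`. -/
noncomputable def scalarMatrix (X : Set G) (r : R) : TranslationRing X R :=
  ⟨Matrix.diagonal fun _ => r, {1}, Set.finite_singleton 1, fun x y h =>
    Matrix.diagonal_apply_ne _ fun hxy => h ⟨1, rfl, by simp [hxy]⟩⟩

open scoped Classical in
theorem scalarMatrix_apply (r : R) (x y : X) :
    (scalarMatrix X r).toMatrix x y = if x = y then r else 0 :=
  Matrix.diagonal_apply ..

/-- The embedding of `R` as the scalar matrices. -/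
noncomputable def scalar (X : Set G) (R : Type*) [Ring R] : R →+* TranslationRing X R where
  toFun := scalarMatrix X
  map_zero' := ext_matrix fun x y => by rw [scalarMatrix_apply, zero_apply, ite_self]
  map_one' := ext_matrix fun x y => by rw [scalarMatrix_apply, one_apply]
  map_add' r s := ext_matrix fun x y => by
    simp only [add_apply, scalarMatrix_apply]
    split_ifs <;> simp
  map_mul' r s := ext_matrix fun x y => by
    rw [mul_apply_eq_sum _ _ x y {x} fun z hz => ?_]
    · by_cases h : x = y <;> simp [scalarMatrix_apply, h]
    · by_contra h
      rw [Finset.mem_singleton] at h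
      exact hz (by rw [scalarMatrix_apply, if_neg (Ne.symm h)])

/-- The entry map as an additive homomorphism. -/
def entry (x y : X) : TranslationRing X R →+ R where
  toFun M := M.toMatrix x y
  map_zero' := zero_apply x y
  map_add' M N := add_apply M N x y

theorem sum_apply {ι : Type*} (s : Finset ι) (M : ι → TranslationRing X R) (x y : X) :
    (∑ i ∈ s, M i).toMatrix x y = ∑ i ∈ s, (M i).toMatrix x y :=
  map_sum (entry x y) M s

end TranslationRing

/-! ### The Følner condition and UGN -/

section Neighbourhood

variable {G : Type*} [Group G] (X : Set G)

open scoped Classical in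
/-- The set `Kx ∩ X`. -/
noncomputable def translates (K : Finset G) (x : X) : Finset X :=
  (K.image fun k => k * (x : G)).subtype (· ∈ X)

theorem mem_translates {K : Finset G} {x y : X} :
    y ∈ translates X K x ↔ ∃ k ∈ K, k * (x : G) = y := by
  simp only [translates, Finset.mem_subtype, Finset.mem_image]

open scoped Classical in
/-- The Følner condition for a subset `X` of a group: for every finite set `K` and every `n > 0`
there is a finite subset `F` of `X` with `|KF ∩ X| < (1 + 1 / n) |F|`. -/
def HasFolner : Prop :=
  ∀ n : ℕ, 0 < n → ∀ K : Finset G, ∃ F : Finset X,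
    n * (F.biUnion (translates X K)).card < (n + 1) * F.card

/-- If the Følner condition fails, Hall's theorem embeds `n + 1` copies of `X` into `n` copies by
a map that moves points by a bounded amount. -/
theorem exists_injective_of_not_hasFolner (h : ¬ HasFolner X) :
    ∃ n : ℕ, 0 < n ∧ ∃ (K : Finset G) (φ : X × Fin (n + 1) → X × Fin n),
      Function.Injective φ ∧ ∀ p, (φ p).1 ∈ translates X K p.1 := by
  classical
  simp only [HasFolner, not_forall, not_exists, not_lt] at h
  obtain ⟨n, hn, K, h⟩ := h
  refine ⟨n, hn, K, ?_⟩
  have hall := (Finset.all_card_le_biUnion_card_iff_exists_injective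
    fun p : X × Fin (n + 1) => translates X K p.1 ×ˢ (Finset.univ : Finset (Fin n))).1 fun s => by
      let F := s.image Prod.fst
      calc s.card ≤ (F ×ˢ (Finset.univ : Finset (Fin (n + 1)))).card :=
            Finset.card_le_card fun p hp => by
              simpa [F] using ⟨p.2, hp⟩
        _ ≤ n * (F.biUnion (translates X K)).card := by
            rw [Finset.card_product, Finset.card_univ, Fintype.card_fin, mul_comm]
            convert h F
        _ = (F.biUnion (translates X K) ×ˢ (Finset.univ : Finset (Fin n))).card := by
            rw [Finset.card_product, Finset.card_univ, Fintype.card_fin, mul_comm]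
        _ ≤ _ := Finset.card_le_card fun p hp => by
            simp only [Finset.mem_product, Finset.mem_biUnion, F, Finset.mem_image] at hp ⊢
            obtain ⟨⟨_, ⟨q, hq, rfl⟩, hx⟩, hp⟩ := hp
            exact ⟨q, hq, hx, hp⟩
  obtain ⟨φ, hφ, hφK⟩ := hall
  exact ⟨φ, hφ, fun p => (Finset.mem_product.1 (hφK p)).1⟩

variable {X}

/-- The graph of φ is a 0-1 matrix and its transpose is a right inverse by injectivity. Bounded
displacement, by K and by K⁻¹, puts both over the translation ring. -/
theorem not_hasUGN_of_injective {n : ℕ} (hn : 0 < n) {K : Finset G}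
    {φ : X × Fin (n + 1) → X × Fin n} (hφ : Function.Injective φ)
    (hφK : ∀ p, (φ p).1 ∈ translates X K p.1) (R : Type*) [Ring R] :
    ¬ HasUGN (TranslationRing X R) := by
  classical
  rw [hasUGN_iff_matrix]
  push Not
  let A : Matrix (Fin (n + 1)) (Fin n) (TranslationRing X R) := fun i j =>
    ⟨fun x y => if φ (x, i) = (y, j) then 1 else 0, K, K.finite_toSet, fun x y hxy =>
      if_neg fun hp => hxy (by
        have := (mem_translates X).1 (hφK (x, i))
        rw [hp] at this
        exact this)⟩
  let B : Matrix (Fin n) (Fin (n + 1)) (TranslationRing X R) := fun j i =>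
    ⟨fun y x => if φ (x, i) = (y, j) then 1 else 0, (K⁻¹ : Set G), K.finite_toSet.inv,
      fun y x hxy => if_neg fun hp => hxy (by
        have := (mem_translates X).1 (hφK (x, i))
        rw [hp] at this
        obtain ⟨k, hk, hky⟩ := this
        exact ⟨k⁻¹, by simpa using hk, inv_mul_eq_iff_eq_mul.2 hky.symm⟩)⟩
  refine ⟨n, hn, A, B, ?_⟩
  ext i k
  refine TranslationRing.ext_matrix fun x y => ?_
  rw [Matrix.mul_apply, TranslationRing.sum_apply]
  have hA : ∀ j, ∀ z, (A i j).toMatrix x z ≠ 0 → z ∈ ({(φ (x, i)).1} : Finset X) := by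
    intro j z hz
    by_contra hne
    refine hz (if_neg fun hp => hne ?_)
    simp [hp]
  rw [Finset.sum_congr rfl fun j _ => TranslationRing.mul_apply_eq_sum _ _ x y _ (hA j)]
  simp only [Finset.sum_singleton]
  rw [Finset.sum_eq_single (φ (x, i)).2]
  · have hAone : (A i (φ (x, i)).2).toMatrix x (φ (x, i)).1 = 1 := if_pos rfl
    have hB : (B (φ (x, i)).2 k).toMatrix (φ (x, i)).1 y =
      if φ (y, k) = φ (x, i) then 1 else 0 := rfl
    rw [hAone, hB, one_mul]
    by_cases hik : i = k
    · subst hik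
      rw [Matrix.one_apply_eq, TranslationRing.one_apply]
      refine if_congr ?_ rfl rfl
      rw [hφ.eq_iff]
      simp [eq_comm]
    · rw [Matrix.one_apply_ne hik, TranslationRing.zero_apply, if_neg]
      rw [hφ.eq_iff]
      simp [Ne.symm hik]
  · intro j _ hj
    have : (A i j).toMatrix x (φ (x, i)).1 = 0 := if_neg fun hp => hj (by rw [hp])
    rw [this, zero_mul]
  · simp

/-- The rows of `A` over F are supported in E = LF ∩ X, so truncating to F and E keeps the product
equal to 1. Over R this needs (n+1)|F| ≤ n|E|, which the choice of F excludes. -/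
theorem HasFolner.hasUGN_translationRing (hX : HasFolner X) {R : Type*} [Ring R]
    (hR : HasUGN R) : HasUGN (TranslationRing X R) := by
  classical
  rw [hasUGN_iff_matrix]
  intro n hn A B hAB
  choose K hK hAK using fun (i : Fin (n + 1)) (j : Fin n) => (A i j).toMatrix_mem
  let L : Finset G := Finset.univ.biUnion fun i => Finset.univ.biUnion fun j => (hK i j).toFinset
  obtain ⟨F, hF⟩ := hX n hn L
  let E := F.biUnion (translates X L)
  have hE : ∀ i j, ∀ x ∈ F, ∀ z, (A i j).toMatrix x z ≠ 0 → z ∈ E := by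
    intro i j x hx z hz
    obtain ⟨k, hk, hkz⟩ := not_imp_comm.1 (hAK i j x z) hz
    refine Finset.mem_biUnion.2 ⟨x, hx, (mem_translates X).2 ⟨k, ?_, hkz⟩⟩
    simp only [L, Finset.mem_biUnion, Set.Finite.mem_toFinset]
    exact ⟨i, Finset.mem_univ _, j, Finset.mem_univ _, hk⟩
  let A' : Matrix (F × Fin (n + 1)) (E × Fin n) R := fun p q => (A p.2 q.2).toMatrix p.1 q.1
  let B' : Matrix (E × Fin n) (F × Fin (n + 1)) R := fun q p => (B q.2 p.2).toMatrix q.1 p.1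
  have hAB' : A' * B' = 1 := by
    ext ⟨x, i⟩ ⟨y, k⟩
    have := congrArg (fun M => TranslationRing.toMatrix M (x : X) (y : X))
      (congrFun (congrFun hAB i) k)
    simp only [Matrix.mul_apply, TranslationRing.sum_apply] at this
    rw [Finset.sum_congr rfl fun j _ =>
      TranslationRing.mul_apply_eq_sum _ _ (x : X) (y : X) E (hE i j x x.2)] at this
    rw [Matrix.mul_apply, Fintype.sum_prod_type_right]
    refine Eq.trans (Finset.sum_congr rfl fun j _ => ?_) (this.trans ?_)
    · exact Finset.sum_coe_sort E fun z => (A i j).toMatrix x z * (B j k).toMatrix z y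
    · by_cases hik : i = k
      · subst hik
        rw [Matrix.one_apply_eq, TranslationRing.one_apply, Matrix.one_apply]
        refine if_congr ?_ rfl rfl
        rw [Prod.mk_left_inj, Subtype.coe_inj]
      · rw [Matrix.one_apply_ne hik, TranslationRing.zero_apply, Matrix.one_apply_ne]
        simp [hik]
  have := hR.card_le A' B' hAB'
  simp only [Fintype.card_prod, Fintype.card_coe, Fintype.card_fin] at this
  have h2 : n * E.card < (n + 1) * F.card := by convert hF
  rw [mul_comm n, mul_comm (n + 1)] at h2
  omega

end Neighbourhood
-- The Følner condition and amenability
section Measure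

variable {G : Type*} [Group G]

/-- A finitely additive set function that vanishes on the empty set adds up over finite disjoint
families. -/
theorem biUnion_eq_sum_of_additive {α ι : Type*} {μ : Set α → ENNReal} (h0 : μ ∅ = 0)
    (hadd : ∀ A B : Set α, A ∩ B = ∅ → μ (A ∪ B) = μ A + μ B) (s : Finset ι) (A : ι → Set α)
    (hA : (s : Set ι).PairwiseDisjoint A) : μ (⋃ i ∈ s, A i) = ∑ i ∈ s, μ (A i) := by
  classical
  induction s using Finset.induction_on with
  | empty => simpa using h0
  | insert i s hi ih =>
    rw [Finset.set_biUnion_insert, hadd, Finset.sum_insert hi, ih]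
    · exact hA.subset (by simp)
    · rw [← Set.disjoint_iff_inter_eq_empty, Set.disjoint_iUnion₂_right]
      exact fun j hj => hA (by simp) (by simp [hj]) fun h => hi (h ▸ hj)

theorem mono_of_additive {α : Type*} {μ : Set α → ENNReal}
    (hadd : ∀ A B : Set α, A ∩ B = ∅ → μ (A ∪ B) = μ A + μ B) {A B : Set α} (h : A ⊆ B) :
    μ A ≤ μ B := by
  rw [← Set.union_sdiff_cancel h, hadd _ _ (Set.inter_sdiff_self A B)]
  exact le_self_add

theorem IsAmenableWrt.hasFolner {X : Set G} (hX : IsAmenableWrt X) : HasFolner X := by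
  classical
  obtain ⟨μ, hadd, hinv, hone⟩ := hX
  by_contra hF
  obtain ⟨n, hn, K, φ, hφ, hφK⟩ := exists_injective_of_not_hasFolner X hF
  have h0 : μ ∅ = 0 := by
    have h1 := hadd X ∅ (by simp)
    rw [Set.union_empty, hone] at h1
    exact (ENNReal.add_right_inj (a := 1) (by simp)).1 (by rw [← h1, add_zero])
  -- Points of X that φ sends from copy i to copy j by translation by k. For fixed i these pieces
  -- partition X; for fixed j their translates are disjoint in X. Summing μ both ways compares n+1
  -- with n.
  let A : Fin (n + 1) → Fin n → G → Set G := fun i j k =>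
    {g | ∃ x y : X, (x : G) = g ∧ (y : G) = k * g ∧ φ (x, i) = (y, j)}
  have hrow : ∀ i, ∑ p ∈ Finset.univ ×ˢ K, μ (A i p.1 p.2) = 1 := by
    intro i
    rw [← biUnion_eq_sum_of_additive h0 hadd (Finset.univ ×ˢ K) fun p => A i p.1 p.2]
    · rw [← hone]
      congr 1
      ext g
      simp only [Set.mem_iUnion, Finset.mem_product, Finset.mem_univ, true_and, Prod.exists,
        exists_prop]
      constructor
      · rintro ⟨j, k, -, x, y, rfl, -, -⟩
        exact x.2
      · intro hg
        obtain ⟨k, hk, hky⟩ := (mem_translates X).1 (hφK (⟨g, hg⟩, i))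
        exact ⟨_, k, hk, ⟨g, hg⟩, _, rfl, hky.symm, rfl⟩
    · rintro ⟨j, k⟩ - ⟨j', k'⟩ - hne
      refine Set.disjoint_left.2 ?_
      rintro g ⟨x, y, hx, hy, hxy⟩ ⟨x', y', hx', hy', hxy'⟩
      obtain rfl : x = x' := Subtype.ext (hx.trans hx'.symm)
      obtain ⟨rfl, rfl⟩ := Prod.mk.inj (hxy.symm.trans hxy')
      exact hne (Prod.ext rfl (mul_right_cancel (hy.symm.trans hy')))
  have hcol : ∀ j, ∑ p ∈ Finset.univ ×ˢ K, μ (A p.1 j p.2) ≤ 1 := by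
    intro j
    rw [Finset.sum_congr rfl fun p _ => (hinv p.2 (A p.1 j p.2)).symm,
      ← biUnion_eq_sum_of_additive h0 hadd (Finset.univ ×ˢ K)
        fun p => (fun a => p.2 * a) '' A p.1 j p.2, ← hone]
    · refine mono_of_additive hadd ?_
      simp only [Set.iUnion_subset_iff]
      rintro p - _ ⟨g, ⟨x, y, -, hy, -⟩, rfl⟩
      show p.2 * g ∈ X
      exact hy ▸ y.2
    · rintro ⟨i, k⟩ - ⟨i', k'⟩ - hne
      refine Set.disjoint_left.2 ?_
      rintro _ ⟨g, ⟨x, y, hx, hy, hxy⟩, rfl⟩ ⟨g', ⟨x', y', hx', hy', hxy'⟩, hgg⟩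
      obtain rfl : y = y' := Subtype.ext (hy.trans (hgg.symm.trans hy'.symm))
      obtain ⟨rfl, rfl⟩ := Prod.mk.inj (hφ (hxy.trans hxy'.symm))
      obtain rfl : g = g' := hx.symm.trans hx'
      exact hne (Prod.ext rfl (mul_right_cancel hgg.symm))
  have hle : ((n + 1 : ℕ) : ENNReal) ≤ (n : ℕ) := by
    calc ((n + 1 : ℕ) : ENNReal) = ∑ i : Fin (n + 1), ∑ p ∈ Finset.univ ×ˢ K, μ (A i p.1 p.2) := by
          simp [hrow]
      _ = ∑ j : Fin n, ∑ p ∈ Finset.univ ×ˢ K, μ (A p.1 j p.2) := by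
          simp only [Finset.sum_product]
          exact Finset.sum_comm
      _ ≤ ∑ j : Fin n, 1 := Finset.sum_le_sum fun j _ => hcol j
      _ = _ := by simp
  exact absurd (Nat.cast_le.1 hle) (by omega)

/-- A finitely additive function on subsets of `G`, normalised on `X`, that does not increase when
a subset of `X` is translated, gives rise to a finitely additive invariant one. -/
theorem isAmenableWrt_of_subinvariant {X : Set G} (m : Set G → ENNReal)
    (hadd : ∀ A B : Set G, A ∩ B = ∅ → m (A ∪ B) = m A + m B)
    (hsub : ∀ (g : G) (A : Set G), A ⊆ X → m ((fun a => g * a) '' A) ≤ m A)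
    (hone : m X = 1) : IsAmenableWrt X := by
  classical
  -- A labelling c cuts A into pieces, and the piece labelled g is moved by g. The supremum over
  -- finitely many labels recovers mass that m misses outside X; subinvariance keeps the value at X
  -- from exceeding 1.
  let P : (G → G) → G → Set G → Set G := fun c g A => (fun a => g * a) '' {a | a ∈ A ∧ c a = g}
  have hPadd : ∀ c g A B, A ∩ B = ∅ → m (P c g (A ∪ B)) = m (P c g A) + m (P c g B) := by
    intro c g A B hAB
    rw [← hadd]
    · rw [← Set.image_union]
      refine congrArg (fun T => m ((fun a => g * a) '' T)) (Set.ext fun a => ?_)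
      exact or_and_right
    · rw [← Set.image_inter (mul_right_injective g), Set.image_eq_empty]
      ext a
      have : a ∉ A ∩ B := by simp [hAB]
      simp only [Set.mem_inter_iff, Set.mem_ofPred_eq, Set.mem_empty_iff_false, iff_false] at this ⊢
      tauto
  have h0 : m ∅ = 0 := by
    have h1 := hadd X ∅ (by simp)
    rw [Set.union_empty, hone] at h1
    exact (ENNReal.add_right_inj (a := 1) (by simp)).1 (by rw [← h1, add_zero])
  let σ : Finset G × (G → G) → Set G → ENNReal := fun q A => ∑ g ∈ q.1, m (P q.2 g A)
  have hinv : ∀ (h : G) (A : Set G), ⨆ q, σ q ((fun a => h * a) '' A) ≤ ⨆ q, σ q A := by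
    intro h A
    refine iSup_le fun ⟨S, c⟩ => ?_
    -- Moving ha by g is moving a by gh, so labels are multiplied by h on the right.
    refine le_trans (le_of_eq ?_) (le_iSup (fun q => σ q A) (S.image (· * h), fun a => c (h * a) * h))
    simp only [σ]
    rw [Finset.sum_image fun a _ b _ hab => mul_right_cancel hab]
    refine Finset.sum_congr rfl fun g _ => congrArg m ?_
    ext b
    simp only [P, Set.mem_image, Set.mem_ofPred_eq]
    constructor
    · rintro ⟨_, ⟨⟨a, ha, rfl⟩, hc⟩, rfl⟩
      exact ⟨a, ⟨ha, by rw [hc]⟩, mul_assoc ..⟩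
    · rintro ⟨a, ⟨ha, hc⟩, rfl⟩
      exact ⟨h * a, ⟨⟨a, ha, rfl⟩, mul_right_cancel hc⟩, (mul_assoc ..).symm⟩
  refine ⟨fun A => ⨆ q, σ q A, fun A B hAB => le_antisymm ?_ ?_, fun h A => ?_, le_antisymm ?_ ?_⟩
  · refine iSup_le fun q => ?_
    have : σ q (A ∪ B) = σ q A + σ q B := by
      simp only [σ, ← Finset.sum_add_distrib]
      exact Finset.sum_congr rfl fun g _ => hPadd _ _ _ _ hAB
    rw [this]
    exact add_le_add (le_iSup (fun q => σ q A) q) (le_iSup (fun q => σ q B) q)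
  · refine ENNReal.iSup_add_iSup_le fun ⟨S, c⟩ ⟨T, d⟩ => ?_
    -- Disjointness lets the two labellings be glued, so both suprema are approached at once.
    let e : G → G := fun a => if a ∈ A then c a else d a
    refine le_trans ?_ (le_iSup (fun q => σ q (A ∪ B)) (S ∪ T, e))
    have hsum : σ (S ∪ T, e) (A ∪ B) = σ (S ∪ T, c) A + σ (S ∪ T, d) B := by
      simp only [σ, ← Finset.sum_add_distrib]
      refine Finset.sum_congr rfl fun g _ => ?_
      rw [hPadd _ _ _ _ hAB]
      refine congrArg₂ (fun T T' => m ((fun a => g * a) '' T) + m ((fun a => g * a) '' T'))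
        (Set.ext fun a => and_congr_right fun ha => ?_)
        (Set.ext fun a => and_congr_right fun hb => ?_)
      · simp only [e, if_pos ha]
      · simp only [e]
        rw [if_neg fun ha => (hAB ▸ (⟨ha, hb⟩ : a ∈ A ∩ B) : a ∈ (∅ : Set G))]
    rw [hsum]
    exact add_le_add (Finset.sum_le_sum_of_subset Finset.subset_union_left)
      (Finset.sum_le_sum_of_subset Finset.subset_union_right)
  · refine le_antisymm (hinv h A) ?_
    have := hinv h⁻¹ ((fun a => h * a) '' A)
    simpa only [Set.image_image, inv_mul_cancel_left, Set.image_id'] using this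
  · refine iSup_le fun ⟨S, c⟩ => ?_
    calc σ (S, c) X ≤ ∑ g ∈ S, m {a | a ∈ X ∧ c a = g} :=
          Finset.sum_le_sum fun g _ => hsub g _ fun a ha => ha.1
      _ = m (⋃ g ∈ S, {a | a ∈ X ∧ c a = g}) := by
          refine (biUnion_eq_sum_of_additive h0 hadd S _ ?_).symm
          intro g _ g' _ hne
          exact Set.disjoint_left.2 fun a ha ha' => hne (ha.2.symm.trans ha'.2)
      _ ≤ m X := mono_of_additive hadd (by
          simp only [Set.iUnion_subset_iff]
          exact fun g _ a ha => ha.1)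
      _ = 1 := hone
  · refine le_trans (le_of_eq ?_) (le_iSup (fun q => σ q X) ({1}, fun _ => 1))
    simp [σ, P, hone]

/-- For A ⊆ X, translating F ∩ gA back by g⁻¹ lands in A ∩ N, where N is the neighbourhood of F, so
the count grows by at most |N \ F|. Only subinvariance survives in the limit, as gA may leave X. -/
theorem HasFolner.isAmenableWrt {X : Set G} (hX : HasFolner X) : IsAmenableWrt X := by
  classical
  choose F hF using fun q : ℕ × Finset G => hX (q.1 + 1) q.1.succ_pos (insert 1 q.2)
  have hpos : ∀ q, (F q).card ≠ 0 := fun q h => by simpa [h] using hF q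
  let c : ℕ × Finset G → Set G → ℕ := fun q A => ((F q).filter fun x : X => (x : G) ∈ A).card
  let p : ℕ × Finset G → Set G → ENNReal := fun q A => (c q A : ENNReal) / (F q).card
  let U : Ultrafilter (ℕ × Finset G) := Ultrafilter.of atTop
  have hU : (U : Filter (ℕ × Finset G)) ≤ atTop := Ultrafilter.of_le _
  -- The space of all functions `Set G → ENNReal` is compact, so one ultrafilter serves every
  -- subset.
  obtain ⟨m, hm⟩ : ∃ m, Tendsto p U (𝓝 m) := ⟨(U.map p).lim, (U.map p).le_nhds_lim⟩
  rw [tendsto_pi_nhds] at hm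
  refine isAmenableWrt_of_subinvariant m (fun A B hAB => ?_) (fun g A hA => ?_) ?_
  · refine tendsto_nhds_unique (hm (A ∪ B)) (((hm A).add (hm B)).congr fun q => ?_)
    simp only [p]
    rw [← ENNReal.add_div, ← Nat.cast_add]
    congr 2
    simp only [c]
    rw [← Finset.card_union_of_disjoint]
    · congr 1
      ext x
      simp only [Finset.mem_union, Finset.mem_filter, Set.mem_union]
      tauto
    · refine Finset.disjoint_filter.2 fun x _ hA hB => ?_
      exact (hAB ▸ (⟨hA, hB⟩ : (x : G) ∈ A ∩ B) : (x : G) ∈ (∅ : Set G))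
  · have hbound : ∀ᶠ q in (U : Filter (ℕ × Finset G)),
        p q ((fun a => g * a) '' A) ≤ p q A + ((q.1 : ℕ) : ENNReal)⁻¹ := by
      refine hU ((eventually_ge_atTop (0, {g⁻¹})).mono fun q hq => ?_)
      have hg : g⁻¹ ∈ q.2 := hq.2 (Finset.mem_singleton_self _)
      let N := (F q).biUnion (translates X (insert 1 q.2))
      have hFN : F q ⊆ N := fun x hx =>
        Finset.mem_biUnion.2 ⟨x, hx, (mem_translates X).2 ⟨1, by simp, by simp⟩⟩
      have hcard : c q ((fun a => g * a) '' A) ≤ c q A + (N \ F q).card := by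
        have hmem : ∀ x : X, (x : G) ∈ (fun a => g * a) '' A → g⁻¹ * (x : G) ∈ A := by
          rintro x ⟨a, ha, hax⟩
          rw [← hax]
          simpa using ha
        calc c q ((fun a => g * a) '' A) ≤ (N.filter fun x : X => (x : G) ∈ A).card := by
              refine Finset.card_le_card_of_injOn
                (fun x : X => if h : g⁻¹ * (x : G) ∈ X then ⟨g⁻¹ * x, h⟩ else x) ?_ ?_
              · intro x hx
                rw [Finset.mem_coe, Finset.mem_filter] at hx
                have hxA := hmem x hx.2
                simp only [dif_pos (hA hxA), Finset.coe_filter, Set.mem_ofPred_eq]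
                exact ⟨Finset.mem_biUnion.2 ⟨x, hx.1, (mem_translates X).2
                  ⟨g⁻¹, by simp [hg], rfl⟩⟩, hxA⟩
              · intro x hx y hy hxy
                rw [Finset.mem_coe, Finset.mem_filter] at hx hy
                simp only [dif_pos (hA (hmem x hx.2)), dif_pos (hA (hmem y hy.2)),
                  Subtype.mk.injEq, mul_right_inj] at hxy
                exact Subtype.ext hxy
          _ ≤ (((F q).filter fun x : X => (x : G) ∈ A) ∪ (N \ F q)).card :=
              Finset.card_le_card fun x hx => by
                simp only [Finset.mem_filter, Finset.mem_union, Finset.mem_sdiff] at hx ⊢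
                tauto
          _ ≤ _ := Finset.card_union_le _ _
      have hsmall : q.1 * (N \ F q).card ≤ (F q).card := by
        have h1 := hF q
        have h2 : (N \ F q).card + (F q).card = N.card := Finset.card_sdiff_add_card_eq_card hFN
        have h3 : (q.1 + 1) * N.card < (q.1 + 1 + 1) * (F q).card := by convert h1
        rw [← h2] at h3
        nlinarith
      have hne : ((F q).card : ENNReal) ≠ 0 := by exact_mod_cast hpos q
      calc p q ((fun a => g * a) '' A) ≤ ((c q A + (N \ F q).card : ℕ) : ENNReal) / (F q).card :=
            ENNReal.div_le_div_right (by exact_mod_cast hcard) _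
        _ = p q A + ((N \ F q).card : ENNReal) / (F q).card := by
            rw [Nat.cast_add, ENNReal.add_div]
        _ ≤ _ := by
            gcongr
            rw [ENNReal.div_le_iff hne (ENNReal.natCast_ne_top _), mul_comm, ← div_eq_mul_inv]
            -- For q.1 = 0 the error term is ∞ and the bound is vacuous.
            obtain hq0 | hq0 := Nat.eq_zero_or_pos q.1
            · rw [hq0, Nat.cast_zero, ENNReal.div_zero hne]
              exact le_top
            · rw [ENNReal.le_div_iff_mul_le (by simp [hq0.ne']) (by simp), mul_comm]
              exact_mod_cast hsmall
    have hfst : Tendsto (fun q : ℕ × Finset G => ((q.1 : ℕ) : ENNReal)⁻¹) U (𝓝 0) := by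
      refine ENNReal.tendsto_inv_nat_nhds_zero.comp (Tendsto.mono_left ?_ hU)
      rw [← prod_atTop_atTop_eq]
      exact tendsto_fst
    have := le_of_tendsto_of_tendsto (hm _) ((hm A).add hfst) hbound
    rwa [add_zero] at this
  · refine tendsto_nhds_unique (hm X) (tendsto_const_nhds.congr fun q => ?_)
    have : c q X = (F q).card := by simp [c]
    simp only [p, this]
    exact (ENNReal.div_self (by exact_mod_cast hpos q) (ENNReal.natCast_ne_top _)).symm

end Measure

theorem propositionA {G : Type u} [Group G] (X : Set G) :
    (∀ (R : Type v) [Ring R], HasUGN (TranslationRing X R) ↔ HasUGN R) ↔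
      IsAmenableWrt X := by
  refine ⟨fun h => ?_, fun h R _ => ⟨HasUGN.of_ringHom (TranslationRing.scalar X R),
    h.hasFolner.hasUGN_translationRing⟩⟩
  refine HasFolner.isAmenableWrt ?_
  by_contra hX
  -- One ring with UGN in universe v refutes (i); a lifted ℤ will do.
  obtain ⟨n, hn, K, φ, hφ, hφK⟩ := exists_injective_of_not_hasFolner X hX
  exact not_hasUGN_of_injective hn hφ hφK (ULift.{v} ℤ)
    ((h (ULift.{v} ℤ)).2 (hasUGN_of_commRing _))
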